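/- **Proposition (the group $W_{3,1}$ limits only to singular groups among $W_{3,5/6}^{(a,b)}$).** Let $G=\mathrm{SL}_3(\mathbb R)$. A sequence of subgroups $H_n\le G$ converges to a subgroup $L\le G$ (in the Chabauty sense) if every $h\in L$ is a limit of some sequence $h_n\in H_n$, and whenever $h_n\in H_n$ for all $n$ and a subsequence $h_{n_k}$ converges to $h\in G$, then $h\in L$. A subgroup $L$ is a local limit of $H$ under conjugacy if there are $g_n\in G$ and a subgroup $L'\le G$ such that $g_nHg_n^{-1}\to L'$ and $L$ is the identity component of $L'$. Let $$W_{3,1}=\left\{\begin{pmatrix}p&0&d\\0&q&0\\0&0&r\end{pmatrix}: p,q,r>0,\ pqr=1,\ d\in\mathbb R\right\},$$ and for $(a,b)\in\mathbb R^2\setminus\{(0,0)\}$ let $$W_{3,5}^{(a,b)}=\left\{\begin{pmatrix}e^{at}&x&y\\0&e^{bt}&0\\0&0&e^{-(a+b)t}\end{pmatrix}: t,x,y\in\mathbb R\right\},\qquad W_{3,6}^{(a,b)}=\left\{\begin{pmatrix}e^{at}&0&x\\0&e^{bt}&y\\0&0&e^{-(a+b)t}\end{pmatrix}: t,x,y\in\mathbb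 R\right\}.$$ Call $(a,b)$ singular if at least two of the weights $a$, $b$, $-(a+b)$ are equal. For $t,s\in\mathbb R$ put $u(t,s)=I+tE_{12}+sE_{23}$. Then: 1. If $(a,b)\ne(0,0)$ and $W_{3,5}^{(a,b)}$ or $W_{3,6}^{(a,b)}$ is a local limit of $W_{3,1}$ under conjugacy, then $(a,b)$ is singular. 2. More precisely, for $(a,b)\neq(0,0)$, $W_{3,5}^{(a,b)}$ is a local limit of $W_{3,1}$ if and only if $a=b$ or $a=-(a+b)$, and $W_{3,6}^{(a,b)}$ is a local limit of $W_{3,1}$ if and only if $a=-(a+b)$ or $b=-(a+b)$. 3. Explicitly, for every $c\neq 0$, as $n\to\infty$, $u(n,0)\,W_{3,1}\,u(n,0)^{-1}\to W_{3,5}^{(c,c)}$ and $u(0,n)\,W_{3,1}\,u(0,n)^{-1}\to W_{3,6}^{(-2c,c)}$. 4. If $g_n\in G$ and $g_nW_{3,1}g_n^{-1}\to L$, then there are $k\in\mathrm{SO}(3)$ and real sequences $(t_n)$, $(s_n)$ such that $u(t_n,s_n)\,W_{3,1}\,u(t_n,s_n)^{-1}\to k^{-1}Lk$. 5. If $u(t_n,s_n)\,W_{3,1}\,u(t_n,s_n)^{-1}\to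 L$, then every $h\in L$ is upper triangular; if $(t_n)$ is unbounded, then $h_{11}=h_{22}$ for all $h\in L$; if $(s_n)$ is unbounded, then $h_{22}=h_{33}$ for all $h\in L$; and if both sequences are bounded, then $L$ is conjugate to $W_{3,1}$ in $G$. -/

import Mathlib

open Filter Topology

namespace SL3Limits

/-- The Lie group `SL₃(ℝ)`, with its usual topology as a space of matrices. -/
abbrev G : Type := Matrix.SpecialLinearGroup (Fin 3) ℝ

/-- The conjugate subgroup `g H g⁻¹`. -/
def conj (g : G) (H : Subgroup G) : Subgroup G := H.map (MulAut.conj g).toMonoidHom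

/-- Convergence `Hₙ → L` of a sequence of subgroups in the Chabauty topology: every element of `L`
is a limit of elements of the `Hₙ`, and every limit of a convergent subsequence of a sequence
`hₙ ∈ Hₙ` lies in `L`. -/
def ChabautyTendsto (H : ℕ → Subgroup G) (L : Subgroup G) : Prop :=
  (∀ x ∈ L, ∃ h : ℕ → G, (∀ n, h n ∈ H n) ∧ Tendsto h atTop (𝓝 x)) ∧
  (∀ h : ℕ → G, (∀ n, h n ∈ H n) → ∀ φ : ℕ → ℕ, StrictMono φ →
    ∀ x : G, Tendsto (fun k => h (φ k)) atTop (𝓝 x) → x ∈ L)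

/-- `L` is a local limit of `H` under conjugacy: some sequence of conjugates `gₙ H gₙ⁻¹` converges
to a subgroup `L'` whose identity component is `L`. -/
def IsLocalLimit (H L : Subgroup G) : Prop :=
  ∃ (g : ℕ → G) (L' : Subgroup G),
    ChabautyTendsto (fun n => conj (g n) H) L' ∧
    (L : Set G) = connectedComponentIn (L' : Set G) 1

/-- The connected group `W_{3,1}` (the image under `exp` of its Lie algebra, so that the diagonal
entries are positive). -/
def W31 : Subgroup G where
  carrier := {M | ∃ p q r d : ℝ, 0 < p ∧ 0 < q ∧ 0 < r ∧
    (M : Matrix (Fin 3) (Fin 3) ℝ) = !![p, 0, d; 0, q, 0; 0, 0, r]}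
  one_mem' := ⟨1, 1, 1, 0, by norm_num, by norm_num, by norm_num, by
    rw [Matrix.SpecialLinearGroup.coe_one, Matrix.one_fin_three]⟩
  mul_mem' := by
    rintro A B ⟨p, q, r, d, hp, hq, hr, hA⟩ ⟨p', q', r', d', hp', hq', hr', hB⟩
    refine ⟨p * p', q * q', r * r', p * d' + d * r', by positivity, by positivity, by positivity, ?_⟩
    rw [Matrix.SpecialLinearGroup.coe_mul, hA, hB]
    ext i j
    fin_cases i <;> fin_cases j <;> simp [Matrix.mul_apply, Fin.sum_univ_three]
  inv_mem' := by
    rintro A ⟨p, q, r, d, hp, hq, hr, hA⟩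
    refine ⟨q * r, p * r, p * q, -(d * q), by positivity, by positivity, by positivity, ?_⟩
    rw [Matrix.SpecialLinearGroup.coe_inv, hA, Matrix.adjugate_fin_three]
    ext i j
    fin_cases i <;> fin_cases j <;> simp

/-- The group `W_{3,5}^{(a,b)}`. -/
def W35 (a b : ℝ) : Subgroup G where
  carrier := {M | ∃ t x y : ℝ, (M : Matrix (Fin 3) (Fin 3) ℝ) =
    !![Real.exp (a * t), x, y; 0, Real.exp (b * t), 0; 0, 0, Real.exp (-(a + b) * t)]}
  one_mem' := ⟨0, 0, 0, by
    rw [Matrix.SpecialLinearGroup.coe_one, Matrix.one_fin_three]; simp⟩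
  mul_mem' := by
    rintro A B ⟨t, x, y, hA⟩ ⟨t', x', y', hB⟩
    refine ⟨t + t', Real.exp (a * t) * x' + x * Real.exp (b * t'),
      Real.exp (a * t) * y' + y * Real.exp (-(a + b) * t'), ?_⟩
    rw [Matrix.SpecialLinearGroup.coe_mul, hA, hB]
    ext i j
    fin_cases i <;> fin_cases j <;>
      simp [Matrix.mul_apply, Fin.sum_univ_three, mul_add, Real.exp_add]
  inv_mem' := by
    rintro A ⟨t, x, y, hA⟩
    refine ⟨-t, -(x * Real.exp (-(a + b) * t)), -(Real.exp (b * t) * y), ?_⟩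
    rw [Matrix.SpecialLinearGroup.coe_inv, hA, Matrix.adjugate_fin_three]
    ext i j
    fin_cases i <;> fin_cases j <;> simp [← Real.exp_add] <;> ring_nf

/-- The group `W_{3,6}^{(a,b)}`. -/
def W36 (a b : ℝ) : Subgroup G where
  carrier := {M | ∃ t x y : ℝ, (M : Matrix (Fin 3) (Fin 3) ℝ) =
    !![Real.exp (a * t), 0, x; 0, Real.exp (b * t), y; 0, 0, Real.exp (-(a + b) * t)]}
  one_mem' := ⟨0, 0, 0, by
    rw [Matrix.SpecialLinearGroup.coe_one, Matrix.one_fin_three]; simp⟩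
  mul_mem' := by
    rintro A B ⟨t, x, y, hA⟩ ⟨t', x', y', hB⟩
    refine ⟨t + t', Real.exp (a * t) * x' + x * Real.exp (-(a + b) * t'),
      Real.exp (b * t) * y' + y * Real.exp (-(a + b) * t'), ?_⟩
    rw [Matrix.SpecialLinearGroup.coe_mul, hA, hB]
    ext i j
    fin_cases i <;> fin_cases j <;>
      simp [Matrix.mul_apply, Fin.sum_univ_three, mul_add, Real.exp_add]
  inv_mem' := by
    rintro A ⟨t, x, y, hA⟩
    refine ⟨-t, -(x * Real.exp (b * t)), -(Real.exp (a * t) * y), ?_⟩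
    rw [Matrix.SpecialLinearGroup.coe_inv, hA, Matrix.adjugate_fin_three]
    ext i j
    fin_cases i <;> fin_cases j <;> simp [← Real.exp_add] <;> ring_nf

/-- `(a, b)` is singular: two of the three weights `a`, `b`, `-(a + b)` are equal. -/
def IsSingular (a b : ℝ) : Prop := a = b ∨ a = -(a + b) ∨ b = -(a + b)

/-- The unipotent matrix `I + t E₁₂ + s E₂₃`. -/
def unip (t s : ℝ) : G := ⟨!![1, t, 0; 0, 1, s; 0, 0, 1], by simp [Matrix.det_fin_three]⟩

end SL3Limits

/-!
By Gram–Schmidt, every `g ∈ SL₃(ℝ)` is `k * r` with `k` orthogonal and `r` upper triangular with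
positive diagonal, and `r` differs from some `unip t s` by an element of `W31`. Orthogonal matrices
form a compact set, so up to a rotation only limits of `unip (t n) (s n)`-conjugates occur. These
conjugates are cut out of the upper triangular group by
`h₁₂ = t (h₂₂ - h₁₁)` and `h₂₃ = s (h₃₃ - h₂₂)`. If `t` is unbounded, the limit satisfies
`h₁₁ = h₂₂`, and comparing characteristic polynomials with `diag (eᵃ, eᵇ, e⁻⁽ᵃ⁺ᵇ⁾)` forces
`a = b` or `a = -(a + b)` whenever `W35 a b` is conjugate into it. If `t` is bounded, the first
relation survives for a limit point `τ` of `t`, so the limit preserves the two lines spanned by `e₁`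
and `τ e₁ + e₂`, whereas `W35 a b` preserves only one. Finally `g ↦ w (gᵀ)⁻¹ w⁻¹`, with `w` the
reversal of the coordinates, preserves `W31` and exchanges the groups `W35` and `W36`.
-/

namespace SL3Limits

section Chabauty

variable {H : ℕ → Subgroup G} {L L' : Subgroup G}

lemma mem_conj_iff {g h : G} {H : Subgroup G} : h ∈ conj g H ↔ g⁻¹ * h * g ∈ H := by
  constructor
  · rintro ⟨w, hw, rfl⟩
    simpa [mul_assoc] using hw
  · intro hw
    exact ⟨_, hw, by simp [mul_assoc]⟩

lemma conj_conj (g k : G) (H : Subgroup G) : conj g (conj k H) = conj (g * k) H := by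
  ext h
  simp [mem_conj_iff, mul_assoc]

lemma conj_of_mem {g : G} {H : Subgroup G} (hg : g ∈ H) : conj g H = H := by
  ext h
  rw [mem_conj_iff, Subgroup.mul_mem_cancel_right _ hg,
    Subgroup.mul_mem_cancel_left _ (H.inv_mem hg)]

lemma map_conj (e : G ≃ₜ* G) (g : G) (H : Subgroup G) :
    (conj g H).map (e : G →* G) = conj (e g) (H.map (e : G →* G)) := by
  simp only [conj, Subgroup.map_map]
  congr 1
  ext1 h
  simp

namespace ChabautyTendsto

lemma unique (hL : ChabautyTendsto H L) (hL' : ChabautyTendsto H L') : L = L' := by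
  have le_of_tendsto {K K' : Subgroup G} (hK : ChabautyTendsto H K)
      (hK' : ChabautyTendsto H K') : K ≤ K' := fun x hx =>
    have ⟨h, hh, hhx⟩ := hK.1 x hx
    hK'.2 h hh id strictMono_id x hhx
  exact le_antisymm (le_of_tendsto hL hL') (le_of_tendsto hL' hL)

lemma mem_of_tendsto_subseq (hL : ChabautyTendsto H L) {φ : ℕ → ℕ} (hφ : StrictMono φ)
    {h : ℕ → G} (hh : ∀ n, h n ∈ H (φ n)) {x : G} (hx : Tendsto h atTop (𝓝 x)) : x ∈ L := by
  have extend_mem (m : ℕ) : Function.extend φ h 1 m ∈ H m := by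
    by_cases hm : ∃ n, φ n = m
    · obtain ⟨n, rfl⟩ := hm
      rw [hφ.injective.extend_apply]
      exact hh n
    · rw [Function.extend_apply' _ _ _ hm]
      exact one_mem _
  refine hL.2 _ extend_mem φ hφ x ?_
  simpa only [hφ.injective.extend_apply] using hx

lemma comp_strictMono (hL : ChabautyTendsto H L) {φ : ℕ → ℕ} (hφ : StrictMono φ) :
    ChabautyTendsto (fun n => H (φ n)) L := by
  refine ⟨fun x hx => ?_, fun h hh ψ hψ x hx => ?_⟩
  · obtain ⟨h, hh, hx⟩ := hL.1 x hx
    exact ⟨_, fun n => hh (φ n), hx.comp hφ.tendsto_atTop⟩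
  · exact hL.mem_of_tendsto_subseq (hφ.comp hψ) (fun n => hh (ψ n)) hx

lemma const (hL : IsClosed (L : Set G)) : ChabautyTendsto (fun _ => L) L :=
  ⟨fun x hx => ⟨fun _ => x, fun _ => hx, tendsto_const_nhds⟩, fun _ hh _ _ _ hx =>
    hL.mem_of_tendsto hx (Eventually.of_forall fun _ => hh _)⟩

lemma conj (hL : ChabautyTendsto H L) {k : ℕ → G} {k₀ : G} (hk : Tendsto k atTop (𝓝 k₀)) :
    ChabautyTendsto (fun n => SL3Limits.conj (k n) (H n)) (SL3Limits.conj k₀ L) := by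
  refine ⟨fun x hx => ?_, fun h hh φ hφ x hx => mem_conj_iff.2 ?_⟩
  · obtain ⟨h, hh, hhx⟩ := hL.1 _ (mem_conj_iff.1 hx)
    exact ⟨fun n => k n * h n * (k n)⁻¹, fun n => ⟨h n, hh n, rfl⟩,
      by simpa [mul_assoc] using (hk.mul hhx).mul hk.inv⟩
  · have hkφ := hk.comp hφ.tendsto_atTop
    exact hL.2 (fun n => (k n)⁻¹ * h n * k n) (fun n => mem_conj_iff.1 (hh n)) φ hφ _
      ((hkφ.inv.mul hx).mul hkφ)

lemma map (hL : ChabautyTendsto H L) (e : G ≃ₜ* G) :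
    ChabautyTendsto (fun n => (H n).map (e : G →* G)) (L.map (e : G →* G)) := by
  refine ⟨?_, fun h hh φ hφ x hx => ?_⟩
  · rintro _ ⟨x, hx, rfl⟩
    obtain ⟨h, hh, hhx⟩ := hL.1 x hx
    exact ⟨fun n => e (h n), fun n => ⟨h n, hh n, rfl⟩, (e.continuous.tendsto x).comp hhx⟩
  · choose f hf hfh using hh
    have hfx : Tendsto (fun n => f (φ n)) atTop (𝓝 (e.symm x)) := by
      refine ((e.symm.continuous.tendsto x).comp hx).congr fun n => ?_
      rw [Function.comp_apply, ← hfh]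
      exact e.symm_apply_apply _
    exact ⟨e.symm x, hL.2 f hf φ hφ _ hfx, e.apply_symm_apply x⟩

end ChabautyTendsto

lemma isLocalLimit_of_tendsto {H L : Subgroup G} {g : ℕ → G}
    (hL : ChabautyTendsto (fun n => conj (g n) H) L) (hc : IsPreconnected (L : Set G)) :
    IsLocalLimit H L :=
  ⟨g, L, hL, (hc.connectedComponentIn L.one_mem).symm⟩

lemma IsLocalLimit.map {H L : Subgroup G} (hL : IsLocalLimit H L) (e : G ≃ₜ* G) :
    IsLocalLimit (H.map (e : G →* G)) (L.map (e : G →* G)) := by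
  obtain ⟨g, L', hL', hLL'⟩ := hL
  refine ⟨fun n => e (g n), L'.map (e : G →* G), ?_, ?_⟩
  · simpa only [map_conj] using hL'.map e
  · have hcomp := e.toHomeomorph.image_connectedComponentIn L'.one_mem
    rw [← hLL'] at hcomp
    rw [Subgroup.coe_map, Subgroup.coe_map, ← map_one e]
    exact hcomp

lemma isLocalLimit_map_iff {H L : Subgroup G} (e : G ≃ₜ* G) :
    IsLocalLimit (H.map (e : G →* G)) (L.map (e : G →* G)) ↔ IsLocalLimit H L := by
  have map_symm_map (K : Subgroup G) : (K.map (e : G →* G)).map (e.symm : G →* G) = K := by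
    ext x
    simp [Subgroup.mem_map]
  refine ⟨fun h => ?_, fun h => h.map e⟩
  simpa only [map_symm_map] using h.map e.symm

end Chabauty

section Entries

variable {n : Type*} [Fintype n] [DecidableEq n]

lemma continuous_entry (i j : n) : Continuous fun h : Matrix.SpecialLinearGroup n ℝ => h i j :=
  (continuous_apply_apply i j).comp continuous_subtype_val

lemma tendsto_iff_entry {ι : Type*} {l : Filter ι}
    {f : ι → Matrix.SpecialLinearGroup n ℝ} {g : Matrix.SpecialLinearGroup n ℝ} :
    Tendsto f l (𝓝 g) ↔ ∀ i j, Tendsto (fun k => f k i j) l (𝓝 (g i j)) := by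
  refine Matrix.SpecialLinearGroup.isClosedEmbedding_val.tendsto_nhds_iff.trans ?_
  exact tendsto_pi_nhds.trans (forall_congr' fun _ => tendsto_pi_nhds)

end Entries

section UpperTriangular

variable {n : Type*} [Fintype n] [LinearOrder n]

/-- `h` is upper triangular with positive diagonal entries, i.e. lies in the identity component of
the Borel subgroup of `SLₙ(ℝ)`. -/
structure IsPosUpper (h : Matrix.SpecialLinearGroup n ℝ) : Prop where
  upper : (h : Matrix n n ℝ).IsUpperTriangular
  diag_pos : ∀ i, 0 < h i i

lemma prod_diag_eq_one {h : Matrix.SpecialLinearGroup n ℝ}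
    (hh : (h : Matrix n n ℝ).IsUpperTriangular) : ∏ i, h i i = 1 :=
  (Matrix.det_of_isUpperTriangular hh).symm.trans h.det_coe

lemma isClosed_setOf_isPosUpper :
    IsClosed {h : Matrix.SpecialLinearGroup n ℝ | IsPosUpper h} := by
  have nonneg_iff (h : Matrix.SpecialLinearGroup n ℝ) :
      IsPosUpper h ↔ (∀ i j, j < i → h i j = 0) ∧ ∀ i, 0 ≤ h i i := by
    refine ⟨fun H => ⟨fun i j hij => H.upper hij, fun i => (H.diag_pos i).le⟩, fun H => ?_⟩
    have hupper : (h : Matrix n n ℝ).IsUpperTriangular := fun i j hij => H.1 i j hij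
    exact ⟨hupper, fun i => (H.2 i).lt_of_ne' fun h0 => zero_ne_one <|
      (Finset.prod_eq_zero (f := fun j => h j j) (Finset.mem_univ i) h0).symm.trans
        (prod_diag_eq_one hupper)⟩
  simp only [nonneg_iff, Set.ofPred_and, Set.ofPred_forall]
  exact (isClosed_iInter fun i => isClosed_iInter fun j => isClosed_iInter fun _ =>
    isClosed_eq (continuous_entry i j) continuous_const).inter
    (isClosed_iInter fun i => isClosed_le continuous_const (continuous_entry i i))

end UpperTriangular

section Iwasawa

variable {n : Type*} [Fintype n] [DecidableEq n]

lemma isCompact_orthogonalGroup :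
    IsCompact (Matrix.orthogonalGroup n ℝ : Set (Matrix n n ℝ)) := by
  have hcube : IsCompact (Set.univ.pi fun _ : n => Set.univ.pi fun _ : n => Set.Icc (-1 : ℝ) 1) :=
    isCompact_univ_pi fun _ => isCompact_univ_pi fun _ => isCompact_Icc
  refine hcube.of_isClosed_subset ?_ fun A hA i _ j _ =>
    abs_le.1 (entry_norm_bound_of_unitary (𝕜 := ℝ) hA i j)
  have heq : (Matrix.orthogonalGroup n ℝ : Set (Matrix n n ℝ)) = {A | A * A.transpose = 1} :=
    Set.ext fun A => Matrix.mem_orthogonalGroup_iff n ℝ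
  rw [heq]
  exact isClosed_eq (continuous_id.matrix_mul continuous_id.matrix_transpose) continuous_const

lemma isCompact_setOf_mem_orthogonalGroup :
    IsCompact {k : Matrix.SpecialLinearGroup n ℝ |
      (k : Matrix n n ℝ) ∈ Matrix.orthogonalGroup n ℝ} :=
  Matrix.SpecialLinearGroup.isClosedEmbedding_val.isCompact_preimage isCompact_orthogonalGroup

open InnerProductSpace in
lemma inner_gramSchmidtOrthonormalBasis_self_pos {E ι : Type*} [NormedAddCommGroup E]
    [InnerProductSpace ℝ E] [FiniteDimensional ℝ E] [Fintype ι] [LinearOrder ι]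
    [LocallyFiniteOrderBot ι] [WellFoundedLT ι] (h : Module.finrank ℝ E = Fintype.card ι)
    {f : ι → E} (hf : LinearIndependent ℝ f) (i : ι) :
    0 < inner ℝ (gramSchmidtOrthonormalBasis h f i) (f i) := by
  have hne := gramSchmidt_ne_zero i hf
  have hnormed : gramSchmidtNormed ℝ f i ≠ 0 :=
    norm_ne_zero_iff.1 ((gramSchmidtNormed_unit_length i hf).trans_ne one_ne_zero)
  have hinner : inner ℝ (gramSchmidt ℝ f i) (f i) = ‖gramSchmidt ℝ f i‖ ^ 2 := by
    conv_lhs => rw [gramSchmidt_def'' ℝ f i]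
    rw [inner_add_right, inner_sum, Finset.sum_eq_zero, add_zero, real_inner_self_eq_norm_sq]
    intro j hj
    rw [inner_smul_right, gramSchmidt_orthogonal ℝ f (Finset.mem_Iio.1 hj).ne', mul_zero]
  rw [gramSchmidtOrthonormalBasis_apply h hnormed, gramSchmidtNormed, inner_smul_left, hinner]
  have := norm_pos_iff.2 hne
  simp only [RCLike.ofReal_real_eq_id, id_eq, conj_trivial]
  positivity

lemma exists_orthogonal_inv_mul_isPosUpper {m : ℕ} (g : Matrix.SpecialLinearGroup (Fin m) ℝ) :
    ∃ k : Matrix.SpecialLinearGroup (Fin m) ℝ,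
      (k : Matrix (Fin m) (Fin m) ℝ) ∈ Matrix.orthogonalGroup (Fin m) ℝ ∧
        IsPosUpper (k⁻¹ * g) := by
  let e := EuclideanSpace.basisFun (Fin m) ℝ
  let f : Fin m → EuclideanSpace ℝ (Fin m) := fun j => WithLp.toLp 2 fun i => g i j
  have hfg : e.toBasis.toMatrix f = g := by
    ext i j
    simp [e, f, Module.Basis.toMatrix_apply]
  have hf : LinearIndependent ℝ f := by
    refine ((Module.Basis.is_basis_iff_det e.toBasis).2 ?_).1
    rw [Module.Basis.det_apply, hfg, g.det_coe]
    exact isUnit_one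
  have hcard : Module.finrank ℝ (EuclideanSpace ℝ (Fin m)) = Fintype.card (Fin m) := by simp
  let b := InnerProductSpace.gramSchmidtOrthonormalBasis hcard f
  have hQ := e.toMatrix_orthonormalBasis_mem_unitary b
  set Q := e.toBasis.toMatrix b
  set R := b.toBasis.toMatrix f
  have hQR : Q * R = g := by
    rw [← hfg]
    exact Module.Basis.toMatrix_mul_toMatrix e.toBasis b.toBasis f
  have hR_pos (i : Fin m) : 0 < R i i := by
    have := inner_gramSchmidtOrthonormalBasis_self_pos hcard hf i
    rwa [← OrthonormalBasis.repr_apply_apply] at this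
  have hR := InnerProductSpace.gramSchmidtOrthonormalBasis_inv_isUpperTriangular hcard f
  have hdetR : 0 < R.det := by
    rw [Matrix.det_of_isUpperTriangular hR]
    exact Finset.prod_pos fun i _ => hR_pos i
  have hdetQ : Q.det = 1 := by
    have hsq : Q.det * Q.det = 1 := (Matrix.det_of_mem_unitary hQ).2
    have hmul : Q.det * R.det = 1 := by rw [← Matrix.det_mul, hQR, g.det_coe]
    nlinarith
  have hdetR' : R.det = 1 := by simpa [hdetQ, g.det_coe] using congrArg Matrix.det hQR
  let k : Matrix.SpecialLinearGroup (Fin m) ℝ := ⟨Q, hdetQ⟩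
  let r : Matrix.SpecialLinearGroup (Fin m) ℝ := ⟨R, hdetR'⟩
  have hkr : k⁻¹ * g = r := inv_mul_eq_of_eq_mul (Subtype.ext hQR.symm)
  exact ⟨k, hQ, hkr ▸ ⟨hR, hR_pos⟩⟩

end Iwasawa

section ExpUpper

variable {α β x y z : ℝ}

/-- The upper triangular matrix with diagonal `(e^α, e^β, e^{-(α+β)})` and entries `x`, `y`, `z` in
positions `(1,2)`, `(1,3)`, `(2,3)`. These are coordinates on the upper triangular matrices with
positive diagonal in `SL₃(ℝ)`. -/
noncomputable def expUpper (α β x y z : ℝ) : G :=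
  ⟨!![Real.exp α, x, y; 0, Real.exp β, z; 0, 0, Real.exp (-(α + β))], by
    simp [Matrix.det_fin_three, ← Real.exp_add]⟩

lemma coe_expUpper (α β x y z : ℝ) : (expUpper α β x y z : Matrix (Fin 3) (Fin 3) ℝ) =
    !![Real.exp α, x, y; 0, Real.exp β, z; 0, 0, Real.exp (-(α + β))] := rfl

lemma expUpper_mul (α β x y z α' β' x' y' z' : ℝ) :
    expUpper α β x y z * expUpper α' β' x' y' z' =
      expUpper (α + α') (β + β') (Real.exp α * x' + x * Real.exp β')
        (Real.exp α * y' + x * z' + y * Real.exp (-(α' + β')))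
        (Real.exp β * z' + z * Real.exp (-(α' + β'))) := by
  ext i j
  fin_cases i <;> fin_cases j <;>
    simp [coe_expUpper, Matrix.mul_apply, Fin.sum_univ_three, Real.exp_add]
  ring

lemma expUpper_zero : expUpper 0 0 0 0 0 = 1 := by
  ext i j
  fin_cases i <;> fin_cases j <;> simp [coe_expUpper]

lemma expUpper_inv (α β x y z : ℝ) : (expUpper α β x y z)⁻¹ =
    expUpper (-α) (-β) (-(x * Real.exp (-(α + β)))) (x * z - Real.exp β * y)
      (-(z * Real.exp α)) := by
  refine inv_eq_of_mul_eq_one_right ?_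
  rw [expUpper_mul, ← expUpper_zero]
  congr 1 <;> simp [Real.exp_add, Real.exp_neg] <;> field_simp <;> ring

lemma unip_eq_expUpper (t s : ℝ) : unip t s = expUpper 0 0 t 0 s := by
  ext i j
  fin_cases i <;> fin_cases j <;> simp [unip, coe_expUpper]

lemma tendsto_expUpper {ι : Type*} {l : Filter ι} {α' β' x' y' z' : ι → ℝ}
    (hα : Tendsto α' l (𝓝 α)) (hβ : Tendsto β' l (𝓝 β)) (hx : Tendsto x' l (𝓝 x))
    (hy : Tendsto y' l (𝓝 y)) (hz : Tendsto z' l (𝓝 z)) :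
    Tendsto (fun k => expUpper (α' k) (β' k) (x' k) (y' k) (z' k)) l
      (𝓝 (expUpper α β x y z)) := by
  refine tendsto_iff_entry.2 fun i j => ?_
  fin_cases i <;> fin_cases j <;>
    simp [-neg_add_rev, coe_expUpper, tendsto_const_nhds, hx, hy, hz, hα.rexp, hβ.rexp,
      (hα.add hβ).neg.rexp]

lemma isPosUpper_expUpper (α β x y z : ℝ) : IsPosUpper (expUpper α β x y z) where
  upper i j hij := by
    fin_cases i <;> fin_cases j <;> simp_all [coe_expUpper]
  diag_pos i := by
    fin_cases i <;> simp [coe_expUpper, Real.exp_pos]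

lemma IsPosUpper.exists_eq_expUpper {h : G} (hh : IsPosUpper h) :
    ∃ α β x y z : ℝ, h = expUpper α β x y z := by
  have h22 : h 2 2 = (h 0 0 * h 1 1)⁻¹ :=
    eq_inv_of_mul_eq_one_right ((Fin.prod_univ_three _).symm.trans (prod_diag_eq_one hh.upper))
  have h10 : h 1 0 = 0 := hh.upper (by decide)
  have h20 : h 2 0 = 0 := hh.upper (by decide)
  have h21 : h 2 1 = 0 := hh.upper (by decide)
  refine ⟨Real.log (h 0 0), Real.log (h 1 1), h 0 1, h 0 2, h 1 2, ?_⟩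
  ext i j
  fin_cases i <;> fin_cases j <;>
    simp [coe_expUpper, Real.exp_neg, Real.exp_add, Real.exp_log, hh.diag_pos, h10, h20, h21, h22]

end ExpUpper

section Groups

variable {a b : ℝ} {h : G}

lemma mem_W31_iff : h ∈ W31 ↔ ∃ α β d : ℝ, h = expUpper α β 0 d 0 := by
  constructor
  · rintro ⟨p, q, r, d, hp, hq, -, hh⟩
    have hdet : p * q * r = 1 := by
      have := congrArg Matrix.det hh
      rw [h.det_coe] at this
      simpa [Matrix.det_fin_three] using this.symm
    refine ⟨Real.log p, Real.log q, d, Subtype.ext ?_⟩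
    rw [hh, coe_expUpper, Real.exp_neg, Real.exp_add, Real.exp_log hp, Real.exp_log hq,
      ← eq_inv_of_mul_eq_one_right hdet]
  · rintro ⟨α, β, d, rfl⟩
    exact ⟨_, _, _, _, Real.exp_pos _, Real.exp_pos _, Real.exp_pos _, rfl⟩

lemma mem_W35_iff : h ∈ W35 a b ↔ ∃ t x y : ℝ, h = expUpper (a * t) (b * t) x y 0 := by
  refine exists₃_congr fun t x y => ?_
  rw [neg_mul, add_mul]
  exact ⟨fun H => Subtype.ext H, congrArg Subtype.val⟩

lemma mem_W36_iff : h ∈ W36 a b ↔ ∃ t x y : ℝ, h = expUpper (a * t) (b * t) 0 x y := by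
  refine exists₃_congr fun t x y => ?_
  rw [neg_mul, add_mul]
  exact ⟨fun H => Subtype.ext H, congrArg Subtype.val⟩

lemma isPreconnected_W35 (a b : ℝ) : IsPreconnected (W35 a b : Set G) := by
  have hrange : (W35 a b : Set G) =
      Set.range fun p : ℝ × ℝ × ℝ => expUpper (a * p.1) (b * p.1) p.2.1 p.2.2 0 := by
    ext h
    simp [mem_W35_iff, eq_comm]
  rw [hrange]
  refine isPreconnected_range (continuous_iff_continuousAt.2 fun p => tendsto_expUpper ?_ ?_ ?_ ?_
    tendsto_const_nhds) <;> exact Continuous.tendsto (by fun_prop) p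

lemma mem_W35_self_iff {c : ℝ} (hc : c ≠ 0) :
    h ∈ W35 c c ↔ IsPosUpper h ∧ h 0 0 = h 1 1 ∧ h 1 2 = 0 := by
  rw [mem_W35_iff]
  constructor
  · rintro ⟨t, x, y, rfl⟩
    exact ⟨isPosUpper_expUpper .., by simp [coe_expUpper]⟩
  · rintro ⟨hh, hdiag, h12⟩
    obtain ⟨α, β, x, y, z, rfl⟩ := hh.exists_eq_expUpper
    obtain rfl : α = β := by simpa [coe_expUpper] using hdiag
    obtain rfl : z = 0 := by simpa [coe_expUpper] using h12
    exact ⟨α / c, x, y, by rw [mul_div_cancel₀ _ hc]⟩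

end Groups

section UnipotentConjugates

variable {t s : ℝ} {h : G}

/- Since `u(t,s)` normalizes the upper triangular group, conjugating `W31` by it only changes the
relations `h 0 1 = 0` and `h 1 2 = 0` that cut `W31` out of it. -/
lemma mem_conj_unip_iff : h ∈ conj (unip t s) W31 ↔
    IsPosUpper h ∧ h 0 1 = t * (h 1 1 - h 0 0) ∧ h 1 2 = s * (h 2 2 - h 1 1) := by
  rw [mem_conj_iff, mem_W31_iff]
  constructor
  · rintro ⟨α, β, d, hd⟩
    obtain rfl : h = unip t s * expUpper α β 0 d 0 * (unip t s)⁻¹ := by rw [← hd]; group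
    simp only [unip_eq_expUpper, expUpper_inv, expUpper_mul]
    refine ⟨isPosUpper_expUpper .., ?_, ?_⟩ <;>
      simp only [coe_expUpper, Matrix.of_apply, Matrix.cons_val, zero_add, add_zero, neg_zero,
        Real.exp_zero] <;>
      ring
  · rintro ⟨hh, h01, h12⟩
    obtain ⟨α, β, x, y, z, rfl⟩ := hh.exists_eq_expUpper
    obtain rfl : x = t * (Real.exp β - Real.exp α) := h01
    obtain rfl : z = s * (Real.exp (-(α + β)) - Real.exp β) := h12
    refine ⟨α, β, y + t * s * (Real.exp β - Real.exp α), ?_⟩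
    simp only [unip_eq_expUpper, expUpper_inv, expUpper_mul]
    congr 1 <;> simp <;> ring

lemma isClosed_W31 : IsClosed (W31 : Set G) := by
  have heq : (W31 : Set G) = {h | IsPosUpper h} ∩ {h | h 0 1 = 0} ∩ {h | h 1 2 = 0} := by
    have hconj : conj (unip 0 0) W31 = W31 := by
      rw [unip_eq_expUpper, expUpper_zero, conj_of_mem W31.one_mem]
    ext h
    rw [← hconj, SetLike.mem_coe, mem_conj_unip_iff, zero_mul, zero_mul, ← and_assoc]
    rfl
  rw [heq]
  exact (isClosed_setOf_isPosUpper.inter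
    (isClosed_eq (continuous_entry 0 1) continuous_const)).inter
      (isClosed_eq (continuous_entry 1 2) continuous_const)

end UnipotentConjugates

section UnipotentLimits

variable {t s : ℕ → ℝ} {L : Subgroup G} {h : G}

lemma eq_zero_of_tendsto_mul_of_not_isBounded {u D : ℕ → ℝ} {d x : ℝ}
    (hD : Tendsto D atTop (𝓝 d)) (hu : Tendsto (fun n => u n * D n) atTop (𝓝 x))
    (hunb : ¬ Bornology.IsBounded (Set.range u)) : d = 0 := by
  by_contra hd
  refine hunb (Metric.isBounded_range_of_tendsto u ((hu.div hD hd).congr' ?_))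
  filter_upwards [hD.eventually_ne hd] with n hn
  exact mul_div_cancel_right₀ _ hn

lemma not_isBounded_range_of_tendsto_cobounded {ι X : Type*} [Bornology X] {l : Filter ι} [l.NeBot]
    {u : ι → X} (hu : Tendsto u l (Bornology.cobounded X)) :
    ¬ Bornology.IsBounded (Set.range u) := fun hb =>
  have ⟨k, hk⟩ := (hu.eventually_mem (Bornology.isBounded_def.1 hb)).exists
  hk (Set.mem_range_self k)

lemma isPosUpper_of_tendsto_conj_unip {f : ℕ → G} (hf : ∀ n, f n ∈ conj (unip (t n) (s n)) W31)
    (hfh : Tendsto f atTop (𝓝 h)) : IsPosUpper h :=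
  isClosed_setOf_isPosUpper.mem_of_tendsto hfh
    (Eventually.of_forall fun n => (mem_conj_unip_iff.1 (hf n)).1)

lemma tendsto_mul_sub_of_mem_conj_unip {f : ℕ → G}
    (hf : ∀ n, f n ∈ conj (unip (t n) (s n)) W31) (hfh : Tendsto f atTop (𝓝 h)) :
    Tendsto (fun n => t n * (f n 1 1 - f n 0 0)) atTop (𝓝 (h 0 1)) ∧
      Tendsto (fun n => s n * (f n 2 2 - f n 1 1)) atTop (𝓝 (h 1 2)) := by
  have hentry := tendsto_iff_entry.1 hfh
  exact ⟨(hentry 0 1).congr fun n => (mem_conj_unip_iff.1 (hf n)).2.1,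
    (hentry 1 2).congr fun n => (mem_conj_unip_iff.1 (hf n)).2.2⟩

lemma entry_eq_of_tendsto_conj_unip {f : ℕ → G} (hf : ∀ n, f n ∈ conj (unip (t n) (s n)) W31)
    (hfh : Tendsto f atTop (𝓝 h)) :
    (¬ Bornology.IsBounded (Set.range t) → h 0 0 = h 1 1) ∧
      (¬ Bornology.IsBounded (Set.range s) → h 1 1 = h 2 2) := by
  have hentry := tendsto_iff_entry.1 hfh
  have ⟨hleft, hright⟩ := tendsto_mul_sub_of_mem_conj_unip hf hfh
  exact ⟨fun ht => (sub_eq_zero.1 (eq_zero_of_tendsto_mul_of_not_isBounded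
      ((hentry 1 1).sub (hentry 0 0)) hleft ht)).symm,
    fun hs => (sub_eq_zero.1 (eq_zero_of_tendsto_mul_of_not_isBounded
      ((hentry 2 2).sub (hentry 1 1)) hright hs)).symm⟩

namespace ChabautyTendsto

variable (hL : ChabautyTendsto (fun n => SL3Limits.conj (unip (t n) (s n)) W31) L)
include hL

lemma isPosUpper (hh : h ∈ L) : IsPosUpper h :=
  have ⟨_, hf, hfh⟩ := hL.1 h hh
  isPosUpper_of_tendsto_conj_unip hf hfh

lemma entry_zero_eq_entry_one (ht : ¬ Bornology.IsBounded (Set.range t)) (hh : h ∈ L) :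
    h 0 0 = h 1 1 :=
  have ⟨_, hf, hfh⟩ := hL.1 h hh
  (entry_eq_of_tendsto_conj_unip hf hfh).1 ht

lemma entry_one_eq_entry_two (hs : ¬ Bornology.IsBounded (Set.range s)) (hh : h ∈ L) :
    h 1 1 = h 2 2 :=
  have ⟨_, hf, hfh⟩ := hL.1 h hh
  (entry_eq_of_tendsto_conj_unip hf hfh).2 hs

lemma exists_entry_eq_mul_sub (ht : Bornology.IsBounded (Set.range t)) :
    ∃ τ : ℝ, ∀ h ∈ L, h 0 1 = τ * (h 1 1 - h 0 0) := by
  obtain ⟨τ, -, φ, hφ, hτ⟩ := tendsto_subseq_of_bounded ht Set.mem_range_self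
  refine ⟨τ, fun h hh => ?_⟩
  obtain ⟨f, hf, hfh⟩ := (hL.comp_strictMono hφ).1 h hh
  have hentry := tendsto_iff_entry.1 hfh
  exact tendsto_nhds_unique (tendsto_mul_sub_of_mem_conj_unip hf hfh).1
    (hτ.mul ((hentry 1 1).sub (hentry 0 0)))

lemma exists_eq_conj_of_isBounded (ht : Bornology.IsBounded (Set.range t))
    (hs : Bornology.IsBounded (Set.range s)) : ∃ p : G, L = SL3Limits.conj p W31 := by
  obtain ⟨⟨t₀, s₀⟩, -, φ, hφ, hlim⟩ :=
    tendsto_subseq_of_bounded (x := fun n => (t n, s n)) (ht.prod hs)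
      fun n => ⟨Set.mem_range_self n, Set.mem_range_self n⟩
  have ⟨hlim_t, hlim_s⟩ := (Prod.tendsto_iff ..).1 hlim
  have hunip : Tendsto (fun n => unip (t (φ n)) (s (φ n))) atTop (𝓝 (unip t₀ s₀)) := by
    simp only [unip_eq_expUpper]
    exact tendsto_expUpper tendsto_const_nhds tendsto_const_nhds hlim_t tendsto_const_nhds hlim_s
  exact ⟨unip t₀ s₀, (hL.comp_strictMono hφ).unique ((const isClosed_W31).conj hunip)⟩

end ChabautyTendsto

end UnipotentLimits

section ExplicitLimit

variable {t : ℕ → ℝ} {c : ℝ}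

lemma tendsto_mul_exp_sub_exp (ht : Tendsto t atTop (Bornology.cobounded ℝ)) (α v : ℝ) :
    Tendsto (fun n => t n * (Real.exp (α + (t n)⁻¹ * v) - Real.exp α)) atTop
      (𝓝 (Real.exp α * v)) := by
  have := (Real.hasDerivAt_exp α).hasFDerivAt.lim v (tendsto_norm_cobounded_atTop.comp ht)
  simpa [mul_comm] using this

lemma chabautyTendsto_conj_unip_W35 (ht : Tendsto t atTop (Bornology.cobounded ℝ)) (hc : c ≠ 0) :
    ChabautyTendsto (fun n => conj (unip (t n) 0) W31) (W35 c c) := by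
  refine ⟨fun h hh => ?_, fun f hf φ hφ h hfh => (mem_W35_self_iff hc).2 ?_⟩
  · obtain ⟨r, x, y, rfl⟩ := mem_W35_iff.1 hh
    set α := c * r
    have hinv : Tendsto (fun n => (t n)⁻¹) atTop (𝓝 0) := tendsto_inv₀_cobounded.comp ht
    have hβ : Tendsto (fun n => α + (t n)⁻¹ * (Real.exp (-α) * x)) atTop (𝓝 α) := by
      simpa using (hinv.mul_const (Real.exp (-α) * x)).const_add α
    have hx := tendsto_mul_exp_sub_exp ht α (Real.exp (-α) * x)
    rw [← mul_assoc, ← Real.exp_add, add_neg_cancel, Real.exp_zero, one_mul] at hx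
    exact ⟨_, fun n => mem_conj_unip_iff.2 ⟨isPosUpper_expUpper .., rfl, (zero_mul _).symm⟩,
      tendsto_expUpper tendsto_const_nhds hβ hx tendsto_const_nhds tendsto_const_nhds⟩
  · have hunb := not_isBounded_range_of_tendsto_cobounded (ht.comp hφ.tendsto_atTop)
    have hfφ (n : ℕ) : f (φ n) ∈ conj (unip (t (φ n)) 0) W31 := hf (φ n)
    refine ⟨isPosUpper_of_tendsto_conj_unip hfφ hfh,
      (entry_eq_of_tendsto_conj_unip hfφ hfh).1 hunb, ?_⟩
    have := (tendsto_mul_sub_of_mem_conj_unip hfφ hfh).2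
    simp only [zero_mul] at this
    exact tendsto_nhds_unique this tendsto_const_nhds

end ExplicitLimit

section Contragredient

variable {n : Type*} [Fintype n] [DecidableEq n]

lemma inv_transpose (g : Matrix.SpecialLinearGroup n ℝ) : g⁻¹.transpose = g.transpose⁻¹ :=
  Subtype.ext (Matrix.adjugate_transpose _)

lemma continuous_transpose :
    Continuous (Matrix.SpecialLinearGroup.transpose (n := n) (R := ℝ)) :=
  Continuous.subtype_mk (continuous_subtype_val.matrix_transpose) _

variable (n) in
/-- The contragredient automorphism `g ↦ (gᵀ)⁻¹` of `SLₙ(ℝ)`. -/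
def contragredient : Matrix.SpecialLinearGroup n ℝ ≃ₜ* Matrix.SpecialLinearGroup n ℝ where
  toFun g := g.transpose⁻¹
  invFun g := g⁻¹.transpose
  left_inv g := congrArg Matrix.SpecialLinearGroup.transpose (inv_inv g.transpose)
  right_inv g := inv_inv g
  map_mul' g h := by
    have : (g * h).transpose = h.transpose * g.transpose := Subtype.ext (Matrix.transpose_mul _ _)
    rw [this, mul_inv_rev]
  continuous_toFun := continuous_transpose.inv
  continuous_invFun := continuous_transpose.comp continuous_inv

end Contragredient

section Duality

/-- The permutation matrix reversing the coordinates, with a sign making its determinant `1`. -/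
def reversal : G := ⟨!![0, 0, 1; 0, -1, 0; 1, 0, 0], by simp [Matrix.det_fin_three]⟩

lemma coe_reversal : (reversal : Matrix (Fin 3) (Fin 3) ℝ) = !![0, 0, 1; 0, -1, 0; 1, 0, 0] := rfl

/-- The automorphism `g ↦ w (gᵀ)⁻¹ w⁻¹` of `SL₃(ℝ)`, where `w` reverses the coordinates. It
preserves upper triangularity and exchanges the groups `W35` and `W36`. -/
def dual : G ≃ₜ* G :=
  (contragredient (Fin 3)).trans
    { MulAut.conj reversal with
      continuous_toFun := (continuous_const.mul continuous_id).mul continuous_const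
      continuous_invFun := (continuous_const.mul continuous_id).mul continuous_const }

lemma dual_expUpper (α β x y z : ℝ) : dual (expUpper α β x y z) =
    expUpper (α + β) (-β) (z * Real.exp α) (x * z - Real.exp β * y)
      (x * Real.exp (-(α + β))) := by
  have hdual : dual (expUpper α β x y z) =
      reversal * (expUpper α β x y z).transpose⁻¹ * reversal⁻¹ := rfl
  rw [hdual, ← inv_transpose, mul_inv_eq_iff_eq_mul, expUpper_inv]
  ext i j
  rw [Matrix.SpecialLinearGroup.coe_mul, Matrix.SpecialLinearGroup.coe_mul,
    Matrix.SpecialLinearGroup.coe_transpose, coe_reversal, coe_expUpper, coe_expUpper]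
  fin_cases i <;> fin_cases j <;> simp [Matrix.mul_apply, Fin.sum_univ_three, add_comm β α]

lemma dual_unip (t : ℝ) : dual (unip t 0) = unip 0 t := by
  simp [unip_eq_expUpper, dual_expUpper]

lemma map_dual_W31 : W31.map (dual : G →* G) = W31 := by
  ext h
  simp only [Subgroup.mem_map, mem_W31_iff]
  constructor
  · rintro ⟨_, ⟨α, β, d, rfl⟩, rfl⟩
    exact ⟨_, _, _, (dual_expUpper ..).trans (by simp only [zero_mul]; rfl)⟩
  · rintro ⟨α, β, d, rfl⟩
    refine ⟨_, ⟨α + β, -β, -(Real.exp β * d), rfl⟩, (dual_expUpper ..).trans ?_⟩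
    simp [← mul_assoc, ← Real.exp_add]

lemma map_dual_W35 (a b : ℝ) : (W35 a b).map (dual : G →* G) = W36 (a + b) (-b) := by
  ext h
  simp only [Subgroup.mem_map, mem_W35_iff, mem_W36_iff]
  constructor
  · rintro ⟨_, ⟨t, x, y, rfl⟩, rfl⟩
    exact ⟨t, _, _, (dual_expUpper ..).trans (by simp only [zero_mul, add_mul, neg_mul]; rfl)⟩
  · rintro ⟨t, x, y, rfl⟩
    refine ⟨_, ⟨t, y * Real.exp (a * t + b * t), -(x * Real.exp (-(b * t))), rfl⟩,
      (dual_expUpper ..).trans ?_⟩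
    rw [zero_mul, mul_zero, zero_sub, mul_neg, neg_neg, mul_left_comm, mul_assoc y, ← Real.exp_add,
      ← Real.exp_add, add_neg_cancel, add_neg_cancel, Real.exp_zero, mul_one, mul_one, add_mul,
      neg_mul]

end Duality

section LocalLimits

variable {a b c : ℝ}

lemma chabautyTendsto_conj_unip_W36 {s : ℕ → ℝ} (hs : Tendsto s atTop (Bornology.cobounded ℝ))
    (hc : c ≠ 0) : ChabautyTendsto (fun n => conj (unip 0 (s n)) W31) (W36 (-2 * c) c) := by
  have := (chabautyTendsto_conj_unip_W35 hs (neg_ne_zero.2 hc)).map dual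
  simp only [map_conj, map_dual_W31, map_dual_W35] at this
  convert this using 1
  · exact funext fun n => congrArg (conj · W31) (dual_unip (s n)).symm
  · congr 1 <;> ring

/-- The signed permutation matrix exchanging the last two coordinates. -/
def swapLast : G := ⟨!![1, 0, 0; 0, 0, 1; 0, -1, 0], by simp [Matrix.det_fin_three]⟩

lemma coe_swapLast : (swapLast : Matrix (Fin 3) (Fin 3) ℝ) = !![1, 0, 0; 0, 0, 1; 0, -1, 0] := rfl

lemma swapLast_mul_expUpper (α β x y : ℝ) : swapLast * expUpper α β x y 0 =
    expUpper α (-(α + β)) y (-x) 0 * swapLast := by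
  ext i j
  rw [Matrix.SpecialLinearGroup.coe_mul, Matrix.SpecialLinearGroup.coe_mul, coe_swapLast,
    coe_expUpper, coe_expUpper]
  fin_cases i <;> fin_cases j <;> simp [Matrix.mul_apply, Fin.sum_univ_three]

lemma conj_swapLast_W35 (a b : ℝ) : conj swapLast (W35 a b) = W35 a (-(a + b)) := by
  ext h
  rw [mem_conj_iff]
  simp only [mem_W35_iff, inv_mul_eq_iff_eq_mul, mul_assoc, swapLast_mul_expUpper, mul_left_inj]
  simp only [neg_mul, add_mul]
  constructor
  · rintro ⟨t, x, y, rfl⟩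
    exact ⟨t, y, -x, rfl⟩
  · rintro ⟨t, x, y, rfl⟩
    exact ⟨t, -y, x, by rw [neg_neg]⟩

lemma isLocalLimit_W31_W35 (hab : (a, b) ≠ (0, 0)) (h : a = b ∨ a = -(a + b)) :
    IsLocalLimit W31 (W35 a b) := by
  have ha : a ≠ 0 := by
    rintro rfl
    exact hab (congrArg (Prod.mk 0) (by rcases h with h | h <;> linarith))
  have hlim := chabautyTendsto_conj_unip_W35 tendsto_natCast_atTop_cobounded ha
  rcases h with rfl | h
  · exact isLocalLimit_of_tendsto hlim (isPreconnected_W35 a a)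
  · have hswap := hlim.conj (tendsto_const_nhds (x := swapLast))
    rw [conj_swapLast_W35, show -(a + a) = b by linarith] at hswap
    simp only [conj_conj] at hswap
    exact isLocalLimit_of_tendsto hswap (isPreconnected_W35 a b)

end LocalLimits

section IwasawaReduction

lemma IsPosUpper.exists_conj_eq_conj_unip {b : G} (hb : IsPosUpper b) :
    ∃ t s : ℝ, conj b W31 = conj (unip t s) W31 := by
  obtain ⟨α, β, x, y, z, rfl⟩ := hb.exists_eq_expUpper
  have hdecomp : expUpper α β x y z =
      unip (x * Real.exp (-β)) (z * Real.exp (α + β)) * expUpper α β 0 y 0 := by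
    rw [unip_eq_expUpper, expUpper_mul]
    simp [mul_assoc, ← Real.exp_add]
  refine ⟨x * Real.exp (-β), z * Real.exp (α + β), ?_⟩
  rw [hdecomp, ← conj_conj, conj_of_mem (mem_W31_iff.2 ⟨α, β, y, rfl⟩)]

lemma ChabautyTendsto.exists_unip {g : ℕ → G} {L : Subgroup G}
    (hL : ChabautyTendsto (fun n => SL3Limits.conj (g n) W31) L) :
    ∃ k : G, (k : Matrix (Fin 3) (Fin 3) ℝ) ∈ Matrix.orthogonalGroup (Fin 3) ℝ ∧
      ∃ t s : ℕ → ℝ, ChabautyTendsto (fun n => SL3Limits.conj (unip (t n) (s n)) W31)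
        (SL3Limits.conj k⁻¹ L) := by
  choose k hk hkg using fun n => exists_orthogonal_inv_mul_isPosUpper (g n)
  choose t s hts using fun n => (hkg n).exists_conj_eq_conj_unip
  have : FirstCountableTopology (Matrix (Fin 3) (Fin 3) ℝ) :=
    inferInstanceAs (FirstCountableTopology (Fin 3 → Fin 3 → ℝ))
  have : FirstCountableTopology G :=
    Matrix.SpecialLinearGroup.isClosedEmbedding_val.isInducing.firstCountableTopology
  obtain ⟨k₀, hk₀, φ, hφ, hlim⟩ := isCompact_setOf_mem_orthogonalGroup.tendsto_subseq hk
  refine ⟨k₀, hk₀, t ∘ φ, s ∘ φ, ?_⟩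
  have hconj := (hL.comp_strictMono hφ).conj hlim.inv
  simpa only [conj_conj, Function.comp_apply, hts] using hconj

end IwasawaReduction

section Obstruction

/-- The line spanned by `v` is invariant under every element of `H` (for `v = 0` this is no
condition). -/
def StabilizesLine (H : Subgroup G) (v : Fin 3 → ℝ) : Prop :=
  ∀ h ∈ H, ∃ c : ℝ, (h : Matrix (Fin 3) (Fin 3) ℝ).mulVec v = c • v

lemma StabilizesLine.mono {H K : Subgroup G} {v : Fin 3 → ℝ} (hK : StabilizesLine K v)
    (hHK : H ≤ K) : StabilizesLine H v := fun h hh => hK h (hHK hh)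

lemma StabilizesLine.conj {H : Subgroup G} {v : Fin 3 → ℝ} (hH : StabilizesLine H v) (g : G) :
    StabilizesLine (conj g H) ((g : Matrix (Fin 3) (Fin 3) ℝ).mulVec v) := by
  rintro _ ⟨h, hh, rfl⟩
  obtain ⟨c, hc⟩ := hH h hh
  refine ⟨c, ?_⟩
  have hcomm : MulAut.conj g h * g = g * h := by simp
  have hmat := congrArg (fun m : G => (m : Matrix (Fin 3) (Fin 3) ℝ)) hcomm
  simp only [Matrix.SpecialLinearGroup.coe_mul] at hmat
  exact (Matrix.mulVec_mulVec ..).trans <| by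
    rw [← Matrix.mulVec_smul, ← hc, Matrix.mulVec_mulVec]
    exact congrArg (Matrix.mulVec · v) hmat

lemma StabilizesLine.apply_eq_zero {a b : ℝ} {v : Fin 3 → ℝ} (hv : StabilizesLine (W35 a b) v) :
    v 1 = 0 ∧ v 2 = 0 := by
  have hmem (x y : ℝ) : expUpper 0 0 x y 0 ∈ W35 a b := mem_W35_iff.2 ⟨0, x, y, by simp⟩
  have eq_zero {c u w : ℝ} (hu : u + w = c * u) (hw : w = c * w) : w = 0 := by
    by_contra hne
    have hc : c = 1 := (mul_eq_right₀ hne).1 hw.symm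
    exact hne (by simpa [hc] using hu)
  constructor
  · obtain ⟨c, hc⟩ := hv _ (hmem 1 0)
    have h0 : v 0 + v 1 = c * v 0 := by
      simpa [coe_expUpper, Matrix.mulVec, dotProduct, Fin.sum_univ_three] using congrFun hc 0
    have h1 : v 1 = c * v 1 := by
      simpa [coe_expUpper, Matrix.mulVec, dotProduct, Fin.sum_univ_three] using congrFun hc 1
    exact eq_zero h0 h1
  · obtain ⟨c, hc⟩ := hv _ (hmem 0 1)
    have h0 : v 0 + v 2 = c * v 0 := by
      simpa [coe_expUpper, Matrix.mulVec, dotProduct, Fin.sum_univ_three] using congrFun hc 0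
    have h2 : v 2 = c * v 2 := by
      simpa [coe_expUpper, Matrix.mulVec, dotProduct, Fin.sum_univ_three] using congrFun hc 2
    exact eq_zero h0 h2

lemma stabilizesLine_of_isPosUpper {K : Subgroup G} (hK : ∀ k ∈ K, IsPosUpper k) :
    StabilizesLine K ![1, 0, 0] := fun k hk => by
  refine ⟨k 0 0, ?_⟩
  have h10 : k 1 0 = 0 := (hK k hk).upper (by decide)
  have h20 : k 2 0 = 0 := (hK k hk).upper (by decide)
  ext i
  fin_cases i <;> simp [Matrix.mulVec, dotProduct, Fin.sum_univ_three, h10, h20]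

lemma stabilizesLine_of_entry_eq {K : Subgroup G} {τ : ℝ} (hK : ∀ k ∈ K, IsPosUpper k)
    (hτ : ∀ k ∈ K, k 0 1 = τ * (k 1 1 - k 0 0)) : StabilizesLine K ![τ, 1, 0] := fun k hk => by
  refine ⟨k 1 1, ?_⟩
  have h10 : k 1 0 = 0 := (hK k hk).upper (by decide)
  have h20 : k 2 0 = 0 := (hK k hk).upper (by decide)
  have h21 : k 2 1 = 0 := (hK k hk).upper (by decide)
  ext i
  fin_cases i <;> simp [Matrix.mulVec, dotProduct, Fin.sum_univ_three, h10, h20, h21, hτ k hk]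
  ring

lemma StabilizesLine.entry_eq_zero {K : Subgroup G} {g : G} {a b : ℝ}
    (hK : StabilizesLine K ![1, 0, 0]) (hle : W35 a b ≤ SL3Limits.conj g K) :
    g 1 0 = 0 ∧ g 2 0 = 0 := by
  simpa [Matrix.mulVec, dotProduct, Fin.sum_univ_three] using ((hK.conj g).mono hle).apply_eq_zero

lemma not_W35_le_conj {K : Subgroup G} {g : G} {a b τ : ℝ} (hK : ∀ k ∈ K, IsPosUpper k)
    (hτ : ∀ k ∈ K, k 0 1 = τ * (k 1 1 - k 0 0)) : ¬ W35 a b ≤ conj g K := by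
  intro hle
  obtain ⟨h10, h20⟩ := (stabilizesLine_of_isPosUpper hK).entry_eq_zero hle
  obtain ⟨h11, h21⟩ : g 1 1 = 0 ∧ g 2 1 = 0 := by
    simpa [Matrix.mulVec, dotProduct, Fin.sum_univ_three, h10, h20] using
      (((stabilizesLine_of_entry_eq hK hτ).conj g).mono hle).apply_eq_zero
  refine g.det_ne_zero ?_
  rw [Matrix.det_fin_three, h10, h20, h11, h21]
  ring

lemma eq_or_eq_of_add_eq_of_mul_eq {p q r d : ℝ} (hadd : p + d = q + r) (hmul : p * d = q * r) :
    p = q ∨ p = r := by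
  have : (p - q) * (p - r) = 0 := by linear_combination p * hadd - hmul
  simpa [sub_eq_zero] using this

lemma trace_eq_of_mul_eq_mul {n : Type*} [Fintype n] [DecidableEq n]
    {g k h : Matrix.SpecialLinearGroup n ℝ} (hgk : g * k = h * g) :
    (k : Matrix n n ℝ).trace = (h : Matrix n n ℝ).trace := by
  have hconj : k = g⁻¹ * (h * g) := eq_inv_mul_of_mul_eq hgk
  rw [hconj, Matrix.SpecialLinearGroup.coe_mul, Matrix.trace_mul_comm,
    ← Matrix.SpecialLinearGroup.coe_mul, mul_inv_cancel_right]

lemma entry_zero_zero_eq_of_mul_eq_mul {g k : G} {α β x y z : ℝ} (hk : IsPosUpper k)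
    (hgk : g * k = expUpper α β x y z * g) (h10 : g 1 0 = 0) (h20 : g 2 0 = 0) :
    k 0 0 = Real.exp α := by
  have k10 : k 1 0 = 0 := hk.upper (by decide)
  have k20 : k 2 0 = 0 := hk.upper (by decide)
  have h00 : g 0 0 ≠ 0 := fun h00 => g.det_ne_zero (Matrix.det_eq_zero_of_column_eq_zero 0
    (by simp [Fin.forall_fin_succ, h00, h10, h20]))
  have hentry := congrArg (fun m : G => (m : Matrix (Fin 3) (Fin 3) ℝ) 0 0) hgk
  simp only [Matrix.SpecialLinearGroup.coe_mul, coe_expUpper] at hentry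
  simp only [Matrix.mul_apply, Fin.sum_univ_three, k10, k20, h10, h20, mul_zero, add_zero]
    at hentry
  exact mul_left_cancel₀ h00 (hentry.trans (mul_comm _ _))

lemma weights_eq_of_W35_le_conj {K : Subgroup G} {g : G} {a b : ℝ} (hK : ∀ k ∈ K, IsPosUpper k)
    (hdiag : ∀ k ∈ K, k 0 0 = k 1 1) (hle : W35 a b ≤ conj g K) : a = b ∨ a = -(a + b) := by
  obtain ⟨h10, h20⟩ := (stabilizesLine_of_isPosUpper hK).entry_eq_zero hle
  obtain ⟨k, hk, hkh⟩ := hle (mem_W35_iff.2 ⟨1, 0, 0, rfl⟩)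
  rw [mul_one, mul_one] at hkh
  have hmul : g * k = expUpper a b 0 0 0 * g := by
    rw [← hkh]
    simp
  have hk00 : k 0 0 = Real.exp a := entry_zero_zero_eq_of_mul_eq_mul (hK k hk) hmul h10 h20
  have htrace : k 0 0 + k 1 1 + k 2 2 = Real.exp a + Real.exp b + Real.exp (-(a + b)) := by
    have htr := trace_eq_of_mul_eq_mul hmul
    rw [Matrix.trace_fin_three, Matrix.trace_fin_three] at htr
    exact htr
  have hdet : k 0 0 * k 1 1 * k 2 2 = 1 :=
    (Fin.prod_univ_three _).symm.trans (prod_diag_eq_one (hK k hk).upper)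
  rw [← hdiag k hk, hk00] at htrace hdet
  have hprod : Real.exp a * k 2 2 = Real.exp b * Real.exp (-(a + b)) := by
    rw [← mul_right_inj' (Real.exp_ne_zero a), ← mul_assoc, hdet, ← Real.exp_add,
      ← Real.exp_add, ← Real.exp_zero]
    ring_nf
  exact (eq_or_eq_of_add_eq_of_mul_eq (by linarith) hprod).imp
    (@Real.exp_injective _ _) (@Real.exp_injective _ _)

end Obstruction

section LocalLimitCriterion

variable {a b : ℝ}

lemma IsLocalLimit.weights_W35 (h : IsLocalLimit W31 (W35 a b)) : a = b ∨ a = -(a + b) := by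
  obtain ⟨g, L, hL, hcomp⟩ := h
  obtain ⟨k, -, t, s, hK⟩ := hL.exists_unip
  have hle : W35 a b ≤ conj k (conj k⁻¹ L) := by
    rw [conj_conj, mul_inv_cancel, conj_of_mem L.one_mem]
    exact SetLike.coe_subset_coe.1 (hcomp ▸ connectedComponentIn_subset _ _)
  have hupper := fun h hh => hK.isPosUpper (h := h) hh
  by_cases ht : Bornology.IsBounded (Set.range t)
  · obtain ⟨τ, hτ⟩ := hK.exists_entry_eq_mul_sub ht
    exact (not_W35_le_conj hupper hτ hle).elim
  · exact weights_eq_of_W35_le_conj hupper (fun _ => hK.entry_zero_eq_entry_one ht) hle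

lemma isLocalLimit_W31_W35_iff (hab : (a, b) ≠ (0, 0)) :
    IsLocalLimit W31 (W35 a b) ↔ a = b ∨ a = -(a + b) :=
  ⟨fun h => h.weights_W35, isLocalLimit_W31_W35 hab⟩

lemma isLocalLimit_W31_W36_iff (hab : (a, b) ≠ (0, 0)) :
    IsLocalLimit W31 (W36 a b) ↔ a = -(a + b) ∨ b = -(a + b) := by
  have hW36 : W36 a b = (W35 (a + b) (-b)).map (dual : G →* G) := by
    rw [map_dual_W35]
    congr 1 <;> ring
  have hab' : (a + b, -b) ≠ (0, 0) := by
    simp only [ne_eq, Prod.mk.injEq] at hab ⊢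
    exact fun h => hab ⟨by linarith, by linarith⟩
  have hdual := isLocalLimit_map_iff (H := W31) (L := W35 (a + b) (-b)) dual
  rw [map_dual_W31, ← hW36, isLocalLimit_W31_W35_iff hab'] at hdual
  rw [hdual, or_comm]
  exact or_congr ⟨fun h => by linarith, fun h => by linarith⟩
    ⟨fun h => by linarith, fun h => by linarith⟩

end LocalLimitCriterion

end SL3Limits

theorem mainTheorem5 :
    -- only singular groups occur
    (∀ a b : ℝ, (a, b) ≠ (0, 0) →
      SL3Limits.IsLocalLimit SL3Limits.W31 (SL3Limits.W35 a b) ∨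
        SL3Limits.IsLocalLimit SL3Limits.W31 (SL3Limits.W36 a b) →
      SL3Limits.IsSingular a b) ∧
    -- which singular groups occur
    (∀ a b : ℝ, (a, b) ≠ (0, 0) →
      (SL3Limits.IsLocalLimit SL3Limits.W31 (SL3Limits.W35 a b) ↔
        a = b ∨ a = -(a + b)) ∧
      (SL3Limits.IsLocalLimit SL3Limits.W31 (SL3Limits.W36 a b) ↔
        a = -(a + b) ∨ b = -(a + b))) ∧
    -- explicit realizations
    (∀ c : ℝ, c ≠ 0 →
      SL3Limits.ChabautyTendsto
        (fun n : ℕ => SL3Limits.conj (SL3Limits.unip n 0) SL3Limits.W31)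
        (SL3Limits.W35 c c) ∧
      SL3Limits.ChabautyTendsto
        (fun n : ℕ => SL3Limits.conj (SL3Limits.unip 0 n) SL3Limits.W31)
        (SL3Limits.W36 (-2 * c) c)) ∧
    -- up to a rotation, every conjugation limit is a limit along unipotent matrices
    (∀ (g : ℕ → SL3Limits.G) (L : Subgroup SL3Limits.G),
      SL3Limits.ChabautyTendsto (fun n => SL3Limits.conj (g n) SL3Limits.W31) L →
      ∃ k : SL3Limits.G,
        (k : Matrix (Fin 3) (Fin 3) ℝ) ∈ Matrix.orthogonalGroup (Fin 3) ℝ ∧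
        ∃ t s : ℕ → ℝ,
          SL3Limits.ChabautyTendsto
            (fun n => SL3Limits.conj (SL3Limits.unip (t n) (s n)) SL3Limits.W31)
            (SL3Limits.conj k⁻¹ L)) ∧
    -- limits along unipotent matrices: two diagonal entries coincide if the sequence is unbounded
    (∀ (t s : ℕ → ℝ) (L : Subgroup SL3Limits.G),
      SL3Limits.ChabautyTendsto
        (fun n => SL3Limits.conj (SL3Limits.unip (t n) (s n)) SL3Limits.W31) L →
      (∀ h ∈ L, h 1 0 = 0 ∧ h 2 0 = 0 ∧ h 2 1 = 0) ∧
      (¬ Bornology.IsBounded (Set.range t) → ∀ h ∈ L, h 0 0 = h 1 1) ∧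
      (¬ Bornology.IsBounded (Set.range s) → ∀ h ∈ L, h 1 1 = h 2 2) ∧
      (Bornology.IsBounded (Set.range t) → Bornology.IsBounded (Set.range s) →
        ∃ p : SL3Limits.G, L = SL3Limits.conj p SL3Limits.W31)) := by
  refine ⟨?_, fun a b hab => ⟨SL3Limits.isLocalLimit_W31_W35_iff hab,
    SL3Limits.isLocalLimit_W31_W36_iff hab⟩, fun c hc => ⟨?_, ?_⟩,
    fun g L hL => hL.exists_unip, fun t s L hL => ⟨fun h hh => ?_, fun ht h hh => ?_,
    fun hs h hh => ?_, hL.exists_eq_conj_of_isBounded⟩⟩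
  · rintro a b hab (h | h)
    · exact ((SL3Limits.isLocalLimit_W31_W35_iff hab).1 h).imp_right .inl
    · exact .inr ((SL3Limits.isLocalLimit_W31_W36_iff hab).1 h)
  · exact SL3Limits.chabautyTendsto_conj_unip_W35 tendsto_natCast_atTop_cobounded hc
  · exact SL3Limits.chabautyTendsto_conj_unip_W36 tendsto_natCast_atTop_cobounded hc
  · have hupper := (hL.isPosUpper hh).upper
    exact ⟨hupper (by decide), hupper (by decide), hupper (by decide)⟩
  · exact hL.entry_zero_eq_entry_one ht hh
  · exact hL.entry_one_eq_entry_two hs hh
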